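/- For every real $\varphi$ with $-\pi<\varphi<\pi$, the integrals below converge absolutely and $$\int_0^1\frac{\ln\ln(1/x)\,dx}{1+2x\cos\varphi+x^2}=\int_1^\infty\frac{\ln\ln x\,dx}{1+2x\cos\varphi+x^2}=\frac{\pi}{2\sin\varphi}\,\ln\frac{(2\pi)^{\varphi/\pi}\,\Gamma\left(\frac12+\frac{\varphi}{2\pi}\right)}{\Gamma\left(\frac12-\frac{\varphi}{2\pi}\right)},$$ where for $\varphi=0$ the right-hand side is understood as its limit for $\varphi\to0$ (the singularity there is removable). In particular, for $\varphi=\pi/2$, $$\int_0^1\frac{\ln\ln(1/x)\,dx}{1+x^2}=\int_1^\infty\frac{\ln\ln x\,dx}{1+x^2}=\int_{\pi/4}^{\pi/2}\ln\ln\tan y\,dy=\frac{\pi}{2}\ln\frac{\Gamma(3/4)\sqrt{2\pi}}{\Gamma(1/4)},$$ where the integral over $y$ also converges absolutely; for $\varphi=\pi/3$, $$\int_0^1\frac{\ln\ln(1/x)\,dx}{1+x+x^2}=\int_1^\infty\frac{\ln\ln x\,dx}{1+x+x^2}=\frac{\pi}{\sqrt3}\ln\frac{\Gamma(2/3)(2\pi)^{1/3}}{\Gamma(1/3)};$$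 and for $\varphi=2\pi/3$, $$\int_0^1\frac{\ln\ln(1/x)\,dx}{1-x+x^2}=\int_1^\infty\frac{\ln\ln x\,dx}{1-x+x^2}=\frac{\pi}{\sqrt3}\ln\frac{\Gamma(5/6)(2\pi)^{2/3}}{\Gamma(1/6)}=\frac{2\pi}{\sqrt3}\left[\frac56\ln(2\pi)-\ln\Gamma\left(\tfrac16\right)\right].$$ -/

import Mathlib

open Real MeasureTheory Filter Topology

/-! The substitutions `x = exp t` and `x = exp (-t)` turn both integrals into the integral over `t >
0` of `log t / (2 (cosh t + cos φ))`. Put `δ = π - φ`. The real part of the cotangent series expands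
`sin δ / (cosh t - cos δ)` into kernels `a / (a² + t²)` with `a = 2πn + δ`, `n ∈ ℤ`, and the
integral of `log t` against such a kernel is `π / 2 * log a` for `a > 0`
(`integral_log_mul_div_sq_add_sq`). Termwise integration of the paired series would give a divergent
sum of logarithms. Subtracting `δ / π` times the expansion at `δ = π`, whose left side vanishes
because `sin π = 0`, cures this: the corrected terms are `O((n + 1)⁻² (1 + t²)⁻¹)`
(`exists_abs_fractionTerm_le`). The resulting partial sums of logarithms are differences of the
sequences in Euler's limit formula for `log Gamma` at `1 - x` and `x`, where `x = δ / (2π)`. The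
value at `φ = 0` follows by dominated convergence, the integral over `y` by `x = tan y`, and the
last closed form by the reflection formula. -/

/-! ### Integrals of the logarithm against `a / (a² + t²)`. -/

theorem integrableOn_log_div_one_add_sq :
    IntegrableOn (fun t : ℝ => log t / (1 + t ^ 2)) (Set.Ioi 0) := by
  have hm : Measurable fun t : ℝ => log t / (1 + t ^ 2) := by fun_prop
  rw [← Set.Ioc_union_Ioi_eq_Ioi zero_le_one]
  refine IntegrableOn.union ?_ ?_
  · have h : IntegrableOn log (Set.Ioc 0 1) :=
      (intervalIntegrable_iff_integrableOn_Ioc_of_le zero_le_one).1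
        intervalIntegral.intervalIntegrable_log'
    refine Integrable.mono h hm.aestronglyMeasurable (Eventually.of_forall fun t => ?_)
    rw [norm_div]
    refine div_le_self (norm_nonneg _) ?_
    rw [Real.norm_of_nonneg (by positivity)]
    nlinarith [sq_nonneg t]
  -- The majorant comes from `log t ≤ 2 √t` and `1 + t² ≥ t²`.
  · have h : IntegrableOn (fun t : ℝ => 2 * t ^ (-(3 / 2) : ℝ)) (Set.Ioi 1) :=
      (integrableOn_Ioi_rpow_of_lt (by norm_num) one_pos).const_mul 2
    refine Integrable.mono' h hm.aestronglyMeasurable ?_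
    filter_upwards [ae_restrict_mem measurableSet_Ioi] with t ht
    have ht : (1 : ℝ) < t := ht
    have h0 : 0 < t := by linarith
    have h1 : log t ≤ 2 * t ^ (1 / 2 : ℝ) := by
      have := Real.log_le_rpow_div h0.le (show (0 : ℝ) < 1 / 2 by norm_num)
      linarith
    have h2 : t ^ (-(3 / 2) : ℝ) * t ^ 2 = t ^ (1 / 2 : ℝ) := by
      rw [← rpow_natCast, ← rpow_add h0]
      norm_num
    have h3 : 0 < t ^ (-(3 / 2) : ℝ) := rpow_pos_of_pos h0 _
    rw [Real.norm_of_nonneg (div_nonneg (log_nonneg ht.le) (by positivity)),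
      div_le_iff₀ (by positivity)]
    nlinarith

/-- The substitution `t ↦ 1 / t` preserves `dt / (1 + t²)` on the half-line and changes the sign of
`log t`. -/
theorem integral_log_div_one_add_sq : ∫ t in Set.Ioi (0 : ℝ), log t / (1 + t ^ 2) = 0 := by
  have h := integral_comp_rpow_Ioi (fun t : ℝ => log t / (1 + t ^ 2))
    (show (-1 : ℝ) ≠ 0 by norm_num)
  have h2 : ∫ t in Set.Ioi (0 : ℝ), (|(-1 : ℝ)| * t ^ ((-1 : ℝ) - 1)) •
      (log (t ^ (-1 : ℝ)) / (1 + (t ^ (-1 : ℝ)) ^ 2)) =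
      ∫ t in Set.Ioi (0 : ℝ), -(log t / (1 + t ^ 2)) := by
    refine setIntegral_congr_fun measurableSet_Ioi fun t ht => ?_
    have ht : 0 < t := ht
    have e : t ^ ((-1 : ℝ) - 1) = (t ^ 2)⁻¹ := by
      rw [← rpow_natCast, ← rpow_neg ht.le]
      norm_num
    simp only [e, rpow_neg_one, log_inv, abs_neg, abs_one, one_mul, smul_eq_mul]
    field_simp
    ring
  rw [h2, integral_neg] at h
  linarith

/-- A measurable function decaying like `1 / (1 + t²)` is integrable against the logarithm. -/
theorem integrableOn_log_mul_of_abs_le {f : ℝ → ℝ} (hf : Measurable f) {C : ℝ}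
    (h : ∀ t, 0 < t → |f t| ≤ C / (1 + t ^ 2)) :
    IntegrableOn (fun t => log t * f t) (Set.Ioi 0) := by
  refine Integrable.mono' (integrableOn_log_div_one_add_sq.norm.const_mul C)
    (by fun_prop) ?_
  filter_upwards [ae_restrict_mem measurableSet_Ioi] with t ht
  have hp : (0 : ℝ) < 1 + t ^ 2 := by positivity
  rw [norm_mul, norm_div, Real.norm_of_nonneg hp.le]
  calc ‖log t‖ * ‖f t‖ ≤ ‖log t‖ * (C / (1 + t ^ 2)) :=
        mul_le_mul_of_nonneg_left (h t ht) (norm_nonneg _)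
    _ = C * (‖log t‖ / (1 + t ^ 2)) := by ring

theorem integral_abs_log_mul_le {f : ℝ → ℝ} (hf : Measurable f) {C : ℝ}
    (h : ∀ t, 0 < t → |f t| ≤ C / (1 + t ^ 2)) :
    ∫ t in Set.Ioi (0 : ℝ), ‖log t * f t‖ ≤
      C * ∫ t in Set.Ioi (0 : ℝ), ‖log t / (1 + t ^ 2)‖ := by
  rw [← integral_const_mul]
  refine setIntegral_mono_on (integrableOn_log_mul_of_abs_le hf h).norm
    (integrableOn_log_div_one_add_sq.norm.const_mul C) measurableSet_Ioi fun t ht => ?_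
  have hp : (0 : ℝ) < 1 + t ^ 2 := by positivity
  rw [norm_mul, norm_div, Real.norm_of_nonneg hp.le]
  calc ‖log t‖ * ‖f t‖ ≤ ‖log t‖ * (C / (1 + t ^ 2)) :=
        mul_le_mul_of_nonneg_left (h t ht) (norm_nonneg _)
    _ = C * (‖log t‖ / (1 + t ^ 2)) := by ring

theorem integrableOn_log_mul_div_sq_add_sq {a : ℝ} (ha : 0 < a) :
    IntegrableOn (fun t => log t * (a / (a ^ 2 + t ^ 2))) (Set.Ioi 0) := by
  -- The ratio `a (1 + t²) / (a² + t²)` runs between `1 / a` at `t = 0` and `a` at infinity; the sum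
  -- bounds both.
  refine integrableOn_log_mul_of_abs_le (by fun_prop) (C := a + 1 / a) fun t _ => ?_
  rw [abs_of_nonneg (by positivity), div_le_div_iff₀ (by positivity) (by positivity)]
  have : (a + 1 / a) * (a ^ 2 + t ^ 2) - a * (1 + t ^ 2) = a ^ 3 + t ^ 2 / a := by
    field_simp
    ring
  have : 0 ≤ a ^ 3 + t ^ 2 / a := by positivity
  linarith

/-- Rescaling `t` by `a` splits `log (a * t)` into a constant times an arctangent integral and the
vanishing integral above. -/
theorem integral_log_mul_div_sq_add_sq {a : ℝ} (ha : 0 < a) :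
    ∫ t in Set.Ioi (0 : ℝ), log t * (a / (a ^ 2 + t ^ 2)) = π / 2 * log a := by
  have h := integral_comp_mul_left_Ioi' (fun t => log t * (a / (a ^ 2 + t ^ 2))) 0 ha
  rw [mul_zero] at h
  rw [← h, smul_eq_mul, ← integral_const_mul]
  have h2 : ∫ t in Set.Ioi (0 : ℝ), a * (log (a * t) * (a / (a ^ 2 + (a * t) ^ 2))) =
      ∫ t in Set.Ioi (0 : ℝ), (log a * (1 + t ^ 2)⁻¹ + log t / (1 + t ^ 2)) := by
    refine setIntegral_congr_fun measurableSet_Ioi fun t ht => ?_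
    have ht : 0 < t := ht
    simp only [log_mul ha.ne' ht.ne']
    field_simp
  rw [h2, integral_add (integrable_inv_one_add_sq.integrableOn.const_mul _)
    integrableOn_log_div_one_add_sq, integral_log_div_one_add_sq, integral_const_mul,
    integral_Ioi_inv_one_add_sq]
  simp [mul_comm]

/-! ### Partial fractions of the hyperbolic kernel. -/

theorem re_complexCot_add_mul_I (a b : ℝ) (hb : b ≠ 0) :
    (Complex.cot (a + b * Complex.I)).re = sin (2 * a) / (cosh (2 * b) - cos (2 * a)) := by
  have h1 : Complex.sin (a + b * Complex.I) =
      ((sin a * cosh b : ℝ) : ℂ) + ((cos a * sinh b : ℝ) : ℂ) * Complex.I := by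
    rw [Complex.sin_add_mul_I]; push_cast; ring
  have h2 : Complex.cos (a + b * Complex.I) =
      ((cos a * cosh b : ℝ) : ℂ) + ((-(sin a * sinh b) : ℝ) : ℂ) * Complex.I := by
    rw [Complex.cos_add_mul_I]; push_cast; ring
  have hs : 0 < sinh b ^ 2 := by
    have := Real.sinh_ne_zero.2 hb
    positivity
  have h3 : (sin a * cosh b) * (sin a * cosh b) + (cos a * sinh b) * (cos a * sinh b) =
      (cosh (2 * b) - cos (2 * a)) / 2 := by
    rw [cosh_two_mul, cos_two_mul']
    linear_combination (sin a ^ 2 - 1 / 2) * cosh_sq b + (sinh b ^ 2 + 1 / 2) * sin_sq_add_cos_sq a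
  have h4 : cosh (2 * b) - cos (2 * a) = 2 * sinh b ^ 2 + 2 * sin a ^ 2 := by
    rw [cosh_two_mul, cos_two_mul', cosh_sq]
    nlinarith [sin_sq_add_cos_sq a]
  have h5 : 0 < cosh (2 * b) - cos (2 * a) := by rw [h4]; positivity
  rw [Complex.cot, h1, h2, Complex.div_re, Complex.normSq_add_mul_I]
  simp only [Complex.add_re, Complex.ofReal_re, Complex.mul_re, Complex.I_re, mul_zero,
    Complex.ofReal_im, Complex.I_im, mul_one, sub_self, add_zero, Complex.add_im,
    Complex.mul_im, zero_add, pow_two, h3]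
  rw [← add_div, div_eq_div_iff (by positivity) h5.ne', sin_two_mul]
  have := cosh_sq b
  linear_combination (sin a * cos a * (cosh (2 * b) - cos (2 * a))) * this

/-- Partial fraction expansion of `sin δ / (cosh t - cos δ)` in `t`. -/
theorem hasSum_partial_fraction_cosh_sub_cos (δ : ℝ) {t : ℝ} (ht : 0 < t) :
    HasSum (fun n : ℕ =>
        (2 * π * (n + 1) + δ) / ((2 * π * (n + 1) + δ) ^ 2 + t ^ 2) -
        (2 * π * (n + 1) - δ) / ((2 * π * (n + 1) - δ) ^ 2 + t ^ 2))
      (sin δ / (cosh t - cos δ) / 2 - δ / (δ ^ 2 + t ^ 2)) := by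
  have hpi := pi_pos
  -- The expansion is the real part of the series for `π cot (π x)` at this point, which is off the
  -- real axis, hence no pole. The polar term `1 / x` becomes `δ / (δ² + t²)`.
  set x : ℂ := ((δ / (2 * π) : ℝ) : ℂ) + ((t / (2 * π) : ℝ) : ℂ) * Complex.I with hx
  have hxim : x.im = t / (2 * π) := by
    simp only [hx, Complex.add_im, Complex.ofReal_im, Complex.im_ofReal_mul, Complex.I_im]; ring
  have hxre : x.re = δ / (2 * π) := by
    simp only [hx, Complex.add_re, Complex.ofReal_re, Complex.re_ofReal_mul, Complex.I_re]; ring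
  have hxm : x ∈ Complex.integerComplement := by
    rintro ⟨m, hm⟩
    have := congrArg Complex.im hm
    rw [hxim, Complex.intCast_im] at this
    have h : 0 < t / (2 * π) := by positivity
    linarith
  have h1 := (summable_cotTerm hxm).hasSum
  have h2 := cot_series_rep' hxm
  have h1' : HasSum (fun n : ℕ => 1 / (x - (n + 1)) + 1 / (x + (n + 1)))
      (π * Complex.cot (π * x) - 1 / x) := by
    rw [h2]; exact h1
  have h3 := (Complex.hasSum_re h1').mul_left (1 / (2 * π))
  have hinv : ∀ m : ℝ, (1 / (x + m)).re =
      2 * π * ((2 * π * m + δ) / ((2 * π * m + δ) ^ 2 + t ^ 2)) := by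
    intro m
    rw [one_div, Complex.inv_re, Complex.normSq_apply]
    simp only [Complex.add_re, Complex.add_im, Complex.ofReal_re, Complex.ofReal_im, hxre, hxim]
    have h : (δ / (2 * π) + m) * (δ / (2 * π) + m) + (t / (2 * π) + 0) * (t / (2 * π) + 0) =
        ((2 * π * m + δ) ^ 2 + t ^ 2) / (2 * π) ^ 2 := by field_simp; ring
    have h0 : (0 : ℝ) < (2 * π * m + δ) ^ 2 + t ^ 2 := by positivity
    rw [h]
    field_simp
    ring
  have hcot : (Complex.cot (π * x)).re = sin δ / (cosh t - cos δ) := by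
    have : (π : ℂ) * x = ((δ / 2 : ℝ) : ℂ) + ((t / 2 : ℝ) : ℂ) * Complex.I := by
      have : (π : ℂ) ≠ 0 := by exact_mod_cast hpi.ne'
      rw [hx]; push_cast; field_simp
    rw [this, re_complexCot_add_mul_I _ _ (by positivity)]
    congr 2 <;> ring_nf
  convert! h3 using 1
  · funext n
    have e1 : x - ((n : ℂ) + 1) = x + ((-(n + 1) : ℝ) : ℂ) := by push_cast; ring
    have e2 : x + ((n : ℂ) + 1) = x + ((n + 1 : ℝ) : ℂ) := by push_cast; ring
    rw [Complex.add_re, e1, e2, hinv, hinv]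
    have e3 : 2 * π * -((n : ℝ) + 1) + δ = -(2 * π * (n + 1) - δ) := by ring
    rw [e3, neg_sq]
    field_simp
    ring
  · have e0 := hinv 0
    simp only [Complex.ofReal_zero, add_zero, mul_zero, zero_add] at e0
    rw [Complex.sub_re, e0, Complex.re_ofReal_mul, hcot]
    field_simp

/-- The `n`-th term of the partial fraction expansion, corrected so that the series
can be integrated termwise against the logarithm. -/
noncomputable def fractionTerm (δ : ℝ) (n : ℕ) (t : ℝ) : ℝ :=
  (2 * π * (n + 1) + δ) / ((2 * π * (n + 1) + δ) ^ 2 + t ^ 2) -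
    (2 * π * (n + 1) - δ) / ((2 * π * (n + 1) - δ) ^ 2 + t ^ 2) -
  δ / π * ((2 * π * (n + 1) + π) / ((2 * π * (n + 1) + π) ^ 2 + t ^ 2) -
    (2 * π * (n + 1) - π) / ((2 * π * (n + 1) - π) ^ 2 + t ^ 2))

theorem measurable_fractionTerm (δ : ℝ) (n : ℕ) : Measurable (fractionTerm δ n) := by
  unfold fractionTerm
  fun_prop

/-- Since `sin π = 0`, the subtracted expansion at `π` contributes only its polar term. -/
theorem hasSum_fractionTerm (δ : ℝ) {t : ℝ} (ht : 0 < t) :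
    HasSum (fun n => fractionTerm δ n t)
      (sin δ / (cosh t - cos δ) / 2 - δ / (δ ^ 2 + t ^ 2) + δ / π * (π / (π ^ 2 + t ^ 2))) := by
  have h := (hasSum_partial_fraction_cosh_sub_cos δ ht).sub
    ((hasSum_partial_fraction_cosh_sub_cos π ht).mul_left (δ / π))
  convert! h using 1
  simp

theorem div_sq_add_sq_eq_re (a t : ℝ) :
    a / (a ^ 2 + t ^ 2) = (1 / ((a : ℂ) + t * Complex.I)).re := by
  rw [one_div, Complex.inv_re, Complex.normSq_add_mul_I]
  simp

/-- With `z = 2π(n + 1) + i t`, the two pairs are the real parts of `-2δ / (z² - δ²)` and `-2π / (z²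
- π²)`. The factor `δ / π` cancels their `z⁻²` parts, leaving a constant over `(z² - δ²)(z² - π²)`.
Order `|z|⁻⁴` suffices to split off both `(n + 1)⁻²` and `(1 + t²)⁻¹`. -/
theorem exists_abs_fractionTerm_le {δ : ℝ} (h0 : 0 < δ) (h1 : δ < 2 * π) :
    ∃ C : ℝ, ∀ (n : ℕ) (t : ℝ), 0 < t →
      |fractionTerm δ n t| ≤ C * (1 / ((n : ℝ) + 1) ^ 2) / (1 + t ^ 2) := by
  have hpi := pi_pos
  have key : ∀ s : ℝ, 0 < s → s < 2 * π → ∃ κ : ℝ, 0 < κ ∧ ∀ (n : ℕ) (t σ : ℝ),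
      |σ| = s →
      κ * (((n : ℝ) + 1) ^ 2 + t ^ 2) ≤ ‖((2 * π * (n + 1) + σ : ℝ) : ℂ) + t * Complex.I‖ ^ 2 := by
    intro s hs0 hs1
    -- The real part is at least `(n + 1)(2π - s)`, because `s ≤ (n + 1) s`.
    refine ⟨min 1 ((2 * π - s) ^ 2), lt_min one_pos (by nlinarith), fun n t σ hσ => ?_⟩
    rw [← Complex.normSq_eq_norm_sq, Complex.normSq_add_mul_I]
    have hn : (0 : ℝ) ≤ n := n.cast_nonneg
    have hle : ((n : ℝ) + 1) * (2 * π - s) ≤ 2 * π * (n + 1) + σ := by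
      have := neg_abs_le σ
      nlinarith
    have hsq : (((n : ℝ) + 1) * (2 * π - s)) ^ 2 ≤ (2 * π * (n + 1) + σ) ^ 2 :=
      pow_le_pow_left₀ (mul_nonneg (by positivity) (by linarith)) hle 2
    have a1 := mul_le_mul_of_nonneg_right (min_le_left 1 ((2 * π - s) ^ 2)) (sq_nonneg t)
    have a2 := mul_le_mul_of_nonneg_right (min_le_right 1 ((2 * π - s) ^ 2))
      (sq_nonneg ((n : ℝ) + 1))
    nlinarith
  obtain ⟨κ, hκ, hk⟩ := key δ h0 h1
  obtain ⟨κ', hκ', hk'⟩ := key π hpi (by linarith)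
  refine ⟨2 * δ * |δ ^ 2 - π ^ 2| / (κ * κ'), fun n t ht => ?_⟩
  set z : ℂ := ((2 * π * (n + 1) : ℝ) : ℂ) + t * Complex.I with hz
  have hzs : ∀ s : ℝ, ((2 * π * (n + 1) + s : ℝ) : ℂ) + t * Complex.I = z + s := by
    intro s; rw [hz]; push_cast; ring
  have hne : ∀ s : ℝ, z + s ≠ 0 := by
    intro s h
    have := congrArg Complex.im h
    simp [hz] at this
    exact ht.ne' this
  have hE : fractionTerm δ n t =
      (1 / (z + δ) - 1 / (z + (-δ : ℝ)) -
        ((δ / π : ℝ) : ℂ) * (1 / (z + π) - 1 / (z + (-π : ℝ)))).re := by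
    rw [← hzs, ← hzs, ← hzs, ← hzs, Complex.sub_re, Complex.re_ofReal_mul, Complex.sub_re,
      Complex.sub_re]
    simp only [← div_sq_add_sq_eq_re, fractionTerm, sub_eq_add_neg]
  have hF : 1 / (z + δ) - 1 / (z + (-δ : ℝ)) -
        ((δ / π : ℝ) : ℂ) * (1 / (z + π) - 1 / (z + (-π : ℝ))) =
      ((-2 * δ * (δ ^ 2 - π ^ 2) : ℝ) : ℂ) /
        ((z + δ) * (z + (-δ : ℝ)) * ((z + π) * (z + (-π : ℝ)))) := by
    have n1 := hne δ
    have n2 := hne (-δ)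
    have n3 := hne π
    have n4 := hne (-π)
    have n5 : (π : ℂ) ≠ 0 := by exact_mod_cast hpi.ne'
    rw [Complex.ofReal_div]
    generalize hq : (π : ℂ) = q at *
    have n4' : z + -q ≠ 0 := by simpa [hq] using n4
    have n2' : z + -(δ : ℂ) ≠ 0 := by simpa using n2
    push_cast
    simp only [hq]
    field_simp
    ring
  have b : ∀ s κ : ℝ, 0 < s → 0 < κ → (∀ (n : ℕ) (t σ : ℝ), |σ| = s →
      κ * (((n : ℝ) + 1) ^ 2 + t ^ 2) ≤
        ‖((2 * π * (n + 1) + σ : ℝ) : ℂ) + t * Complex.I‖ ^ 2) →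
      κ * (((n : ℝ) + 1) ^ 2 + t ^ 2) ≤ ‖(z + s) * (z + (-s : ℝ))‖ := by
    intro s κ hs hκ h
    have i1 := h n t s (abs_of_pos hs)
    have i2 := h n t (-s) (by rw [abs_neg, abs_of_pos hs])
    rw [hzs] at i1 i2
    rw [norm_mul]
    refine le_of_pow_le_pow_left₀ two_ne_zero (by positivity) ?_
    rw [mul_pow ‖_‖, pow_two (κ * _)]
    exact mul_le_mul i1 i2 (by positivity) (by positivity)
  have b1 := b δ κ h0 hκ hk
  have b2 := b π κ' hpi hκ' hk'
  rw [hE, hF]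
  refine (Complex.abs_re_le_norm _).trans ?_
  rw [norm_div, norm_mul ((z + δ) * _), Complex.norm_real]
  have hnum : ‖-2 * δ * (δ ^ 2 - π ^ 2)‖ = 2 * δ * |δ ^ 2 - π ^ 2| := by
    rw [norm_mul, norm_mul, Real.norm_of_nonneg h0.le]
    simp
  rw [hnum]
  have hn : (1 : ℝ) ≤ (n : ℝ) + 1 := by linarith [n.cast_nonneg (α := ℝ)]
  have hn2 : (1 : ℝ) ≤ ((n : ℝ) + 1) ^ 2 := one_le_pow₀ hn
  have hden : κ * κ' * (((n : ℝ) + 1) ^ 2 * (1 + t ^ 2)) ≤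
      ‖(z + δ) * (z + (-δ : ℝ))‖ * ‖(z + π) * (z + (-π : ℝ))‖ := by
    refine le_trans ?_ (mul_le_mul b1 b2 (by positivity) (norm_nonneg _))
    have : ((n : ℝ) + 1) ^ 2 * (1 + t ^ 2) ≤
        (((n : ℝ) + 1) ^ 2 + t ^ 2) * (((n : ℝ) + 1) ^ 2 + t ^ 2) :=
      mul_le_mul (by nlinarith) (by nlinarith) (by positivity) (by positivity)
    calc _ ≤ κ * κ' * ((((n : ℝ) + 1) ^ 2 + t ^ 2) * (((n : ℝ) + 1) ^ 2 + t ^ 2)) :=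
          mul_le_mul_of_nonneg_left this (by positivity)
      _ = _ := by ring
  calc _ ≤ 2 * δ * |δ ^ 2 - π ^ 2| / (κ * κ' * (((n : ℝ) + 1) ^ 2 * (1 + t ^ 2))) :=
        div_le_div_of_nonneg_left (by positivity) (by positivity) hden
    _ = _ := by field_simp

/-! ### Integrability of the kernel and termwise integration. -/

theorem exists_inv_cosh_add_cos_le {φ : ℝ} (h1 : -π < φ) (h2 : φ < π) :
    ∃ C : ℝ, ∀ t : ℝ, 0 < cosh t + cos φ ∧ 1 / (cosh t + cos φ) ≤ C / (1 + t ^ 2) := by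
  have hc : 0 < 1 + cos φ := by
    have h : cos π < cos |φ| :=
      cos_lt_cos_of_nonneg_of_le_pi (abs_nonneg _) le_rfl (abs_lt.2 ⟨h1, h2⟩)
    rw [cos_pi, cos_abs] at h
    linarith
  have hm : 0 < min (1 + cos φ) (1 / 2) := lt_min hc (by norm_num)
  refine ⟨1 / min (1 + cos φ) (1 / 2), fun t => ?_⟩
  -- From `cosh t = 1 + 2 sinh² (t / 2)` and `|u| ≤ |sinh u|`.
  have hcosh : 1 + t ^ 2 / 2 ≤ cosh t := by
    have h := cosh_two_mul (t / 2)
    rw [cosh_sq, mul_div_cancel₀ t two_ne_zero] at h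
    have h3 : |t / 2| ≤ |sinh (t / 2)| := by
      rw [abs_sinh]
      exact self_le_sinh_iff.2 (abs_nonneg _)
    have h4 := sq_le_sq.2 h3
    nlinarith
  have hle : min (1 + cos φ) (1 / 2) * (1 + t ^ 2) ≤ cosh t + cos φ := by
    have a1 := min_le_left (1 + cos φ) (1 / 2)
    have a2 := mul_le_mul_of_nonneg_right (min_le_right (1 + cos φ) (1 / 2)) (sq_nonneg t)
    nlinarith
  refine ⟨lt_of_lt_of_le (by positivity) hle, ?_⟩
  rw [div_div]
  exact one_div_le_one_div_of_le (by positivity) hle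

theorem integrableOn_log_mul_inv_cosh_add_cos {φ : ℝ} (h1 : -π < φ) (h2 : φ < π) :
    IntegrableOn (fun t => log t * (1 / (cosh t + cos φ) / 2)) (Set.Ioi 0) := by
  obtain ⟨C, hC⟩ := exists_inv_cosh_add_cos_le h1 h2
  refine integrableOn_log_mul_of_abs_le (by fun_prop) (C := C) fun t _ => ?_
  obtain ⟨hp, hle⟩ := hC t
  have : 0 < 1 / (cosh t + cos φ) := by positivity
  rw [abs_of_pos (by positivity)]
  linarith

theorem integral_log_mul_fractionTerm {δ : ℝ} (h0 : 0 < δ) (h1 : δ < 2 * π) (n : ℕ) :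
    ∫ t in Set.Ioi (0 : ℝ), log t * fractionTerm δ n t =
      π / 2 * (log (2 * π * (n + 1) + δ) - log (2 * π * (n + 1) - δ) -
        δ / π * (log (2 * π * (n + 1) + π) - log (2 * π * (n + 1) - π))) := by
  have hpi := pi_pos
  have hn : (0 : ℝ) ≤ n := n.cast_nonneg
  have hc : 2 * π ≤ 2 * π * (n + 1) := by nlinarith
  have p1 : 0 < 2 * π * (n + 1) + δ := by linarith
  have p2 : 0 < 2 * π * (n + 1) - δ := by linarith
  have p3 : 0 < 2 * π * (n + 1) + π := by linarith
  have p4 : 0 < 2 * π * (n + 1) - π := by linarith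
  have i1 := integrableOn_log_mul_div_sq_add_sq p1
  have i2 := integrableOn_log_mul_div_sq_add_sq p2
  have i3 := integrableOn_log_mul_div_sq_add_sq p3
  have i4 := integrableOn_log_mul_div_sq_add_sq p4
  simp only [fractionTerm, mul_sub, mul_left_comm (log _) (δ / π)]
  rw [integral_sub (Integrable.sub' i1 i2)
    (Integrable.sub' (i3.const_mul _) (i4.const_mul _)), integral_sub i1 i2,
    integral_sub (i3.const_mul _) (i4.const_mul _), integral_const_mul, integral_const_mul,
    integral_log_mul_div_sq_add_sq p1, integral_log_mul_div_sq_add_sq p2,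
    integral_log_mul_div_sq_add_sq p3, integral_log_mul_div_sq_add_sq p4]
  ring

theorem hasSum_integral_log_mul_fractionTerm {δ : ℝ} (h0 : 0 < δ) (h1 : δ < 2 * π) :
    HasSum (fun n : ℕ => π / 2 * (log (2 * π * (n + 1) + δ) - log (2 * π * (n + 1) - δ) -
        δ / π * (log (2 * π * (n + 1) + π) - log (2 * π * (n + 1) - π))))
      ((∫ t in Set.Ioi (0 : ℝ), log t * (sin δ / (cosh t - cos δ) / 2)) -
        π / 2 * log δ + δ / 2 * log π) := by
  have hpi := pi_pos
  obtain ⟨C, hC⟩ := exists_abs_fractionTerm_le h0 h1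
  have hsum := hasSum_integral_of_summable_integral_norm
    (μ := volume.restrict (Set.Ioi (0 : ℝ))) (F := fun n t => log t * fractionTerm δ n t)
    (fun n => integrableOn_log_mul_of_abs_le (measurable_fractionTerm δ n) (hC n))
    (by
      refine Summable.of_nonneg_of_le (fun n => integral_nonneg fun t => norm_nonneg _)
        (fun n => integral_abs_log_mul_le (measurable_fractionTerm δ n) (hC n)) ?_
      refine Summable.mul_right _ (Summable.mul_left _ ?_)
      exact_mod_cast (summable_nat_add_iff 1).2 (Real.summable_one_div_nat_pow.2 one_lt_two))
  simp only [integral_log_mul_fractionTerm h0 h1] at hsum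
  convert! hsum using 1
  have hK : IntegrableOn (fun t => log t * (sin δ / (cosh t - cos δ) / 2)) (Set.Ioi 0) := by
    have := (integrableOn_log_mul_inv_cosh_add_cos (φ := π - δ) (by linarith)
      (by linarith)).const_mul (sin δ)
    refine this.congr (Eventually.of_forall fun t => ?_)
    simp only [cos_pi_sub]
    ring
  have i1 := integrableOn_log_mul_div_sq_add_sq h0
  have i2 := (integrableOn_log_mul_div_sq_add_sq hpi).const_mul (δ / π)
  have hcongr : ∫ t in Set.Ioi (0 : ℝ), ∑' n, log t * fractionTerm δ n t =
      ∫ t in Set.Ioi (0 : ℝ), (log t * (sin δ / (cosh t - cos δ) / 2) -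
        log t * (δ / (δ ^ 2 + t ^ 2)) + δ / π * (log t * (π / (π ^ 2 + t ^ 2)))) := by
    refine setIntegral_congr_fun measurableSet_Ioi fun t ht => ?_
    rw [((hasSum_fractionTerm δ ht).mul_left (log t)).tsum_eq]
    ring
  rw [hcongr, integral_add (Integrable.sub' hK i1) i2, integral_sub hK i1, integral_const_mul,
    integral_log_mul_div_sq_add_sq h0, integral_log_mul_div_sq_add_sq hpi]
  have : δ / π * (π / 2 * log π) = δ / 2 * log π := by field_simp
  rw [this]

/-! ### Summation to the Gamma function. -/

/-- The factors `2π` and `π` cancel and the correction telescopes to `log (2 * N + 1)`. The range `N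
+ 1` matches `BohrMollerup.logGammaSeq`; `log x` and `log (N + 1 - x)` undo the two extra terms, at
`m = 0` and `m = N`. -/
theorem sum_range_log_ratio {x : ℝ} (h0 : 0 < x) (h1 : x < 1) (N : ℕ) :
    ∑ n ∈ Finset.range N, (π / 2 * (log (2 * π * (n + 1) + 2 * π * x) -
        log (2 * π * (n + 1) - 2 * π * x) -
        2 * π * x / π * (log (2 * π * (n + 1) + π) - log (2 * π * (n + 1) - π)))) =
      π / 2 * (∑ m ∈ Finset.range (N + 1), (log (x + m) - log (1 - x + m)) - log x +
        log (N + 1 - x) - 2 * x * log (2 * N + 1)) := by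
  have hpi := pi_pos
  induction N with
  | zero => simp
  | succ N ih =>
    have hN : (0 : ℝ) ≤ N := N.cast_nonneg
    rw [Finset.sum_range_succ, ih, Finset.sum_range_succ _ (N + 1)]
    have e1 : log (2 * π * (N + 1) + 2 * π * x) = log (2 * π) + log (x + (N + 1)) := by
      rw [← log_mul (by positivity) (by positivity)]; ring_nf
    have e2 : log (2 * π * (N + 1) - 2 * π * x) = log (2 * π) + log (N + 1 - x) := by
      rw [← log_mul (by positivity) (by linarith)]; ring_nf
    have e3 : log (2 * π * (N + 1) + π) = log π + log (2 * N + 3) := by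
      rw [← log_mul (by positivity) (by positivity)]; ring_nf
    have e4 : log (2 * π * (N + 1) - π) = log π + log (2 * N + 1) := by
      rw [← log_mul (by positivity) (by positivity)]; ring_nf
    have e5 : 1 - x + ((N : ℝ) + 1) = N + 1 + 1 - x := by ring
    have e6 : 2 * ((N : ℝ) + 1) + 1 = 2 * N + 3 := by ring
    push_cast
    rw [e1, e2, e3, e4, e5, e6]
    field_simp
    ring

theorem tendsto_sum_range_log_ratio {x : ℝ} (h0 : 0 < x) (h1 : x < 1) :
    Tendsto (fun N : ℕ => ∑ m ∈ Finset.range (N + 1), (log (x + m) - log (1 - x + m)) - log x +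
        log (N + 1 - x) - 2 * x * log (2 * N + 1)) atTop
      (𝓝 (log (Gamma (1 - x)) - log (Gamma x) - log x - 2 * x * log 2)) := by
  have g1 := BohrMollerup.tendsto_log_gamma (x := 1 - x) (by linarith)
  have g2 := BohrMollerup.tendsto_log_gamma h0
  have hinv : Tendsto (fun N : ℕ => (1 : ℝ) / N) atTop (𝓝 0) :=
    tendsto_const_div_atTop_nhds_zero_nat 1
  have l1 : Tendsto (fun N : ℕ => log (1 + (1 - x) * (1 / N))) atTop (𝓝 0) := by
    have h : Tendsto (fun N : ℕ => 1 + (1 - x) * ((1 : ℝ) / N)) atTop (𝓝 1) := by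
      simpa using (hinv.const_mul (1 - x)).const_add 1
    simpa using h.log one_ne_zero
  have l2 : Tendsto (fun N : ℕ => log (2 + 1 / (N : ℝ))) atTop (𝓝 (log 2)) := by
    have h : Tendsto (fun N : ℕ => 2 + (1 : ℝ) / N) atTop (𝓝 2) := by
      simpa using hinv.const_add 2
    exact h.log two_ne_zero
  -- The difference of the two sequences carries `(1 - 2x) log N`, exactly the growth of `log (N + 1
  -- - x) - 2x log (2N + 1)`.
  have h := (((g1.sub g2).sub_const (log x)).add l1).sub (l2.const_mul (2 * x))
  rw [add_zero] at h
  refine h.congr' ?_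
  filter_upwards [eventually_gt_atTop 0] with N hN
  have hN' : (0 : ℝ) < N := Nat.cast_pos.2 hN
  have e1 : log (1 + (1 - x) * (1 / N)) = log (N + 1 - x) - log N := by
    rw [← log_div (by linarith) hN'.ne']
    congr 1
    field_simp
    ring
  have e2 : log (2 + 1 / (N : ℝ)) = log (2 * N + 1) - log N := by
    rw [← log_div (by positivity) hN'.ne']
    congr 1
    field_simp
  rw [e1, e2, Finset.sum_sub_distrib]
  simp only [BohrMollerup.logGammaSeq]
  ring

theorem integral_log_mul_sin_div_cosh_sub_cos {δ : ℝ} (h0 : 0 < δ) (h1 : δ < 2 * π) :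
    ∫ t in Set.Ioi (0 : ℝ), log t * (sin δ / (cosh t - cos δ) / 2) =
      π / 2 * ((1 - δ / π) * log (2 * π) + log (Gamma (1 - δ / (2 * π))) -
        log (Gamma (δ / (2 * π)))) := by
  have hpi := pi_pos
  have hsum := hasSum_integral_log_mul_fractionTerm h0 h1
  obtain ⟨x, rfl⟩ : ∃ x, δ = 2 * π * x := ⟨δ / (2 * π), by field_simp⟩
  have hx0 : 0 < x := by
    by_contra h
    have : 2 * π * x ≤ 0 := mul_nonpos_of_nonneg_of_nonpos (by positivity) (not_lt.1 h)
    linarith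
  have hx1 : x < 1 := by nlinarith
  have ht := hsum.tendsto_sum_nat
  simp only [sum_range_log_ratio hx0 hx1] at ht
  have h := tendsto_nhds_unique ht ((tendsto_sum_range_log_ratio hx0 hx1).const_mul (π / 2))
  rw [log_mul (by positivity) hx0.ne'] at h
  have e : log (2 * π) = log 2 + log π := log_mul two_ne_zero hpi.ne'
  have e1 : 2 * π * x / (2 * π) = x := by field_simp
  have e2 : 2 * π * x / π = 2 * x := by field_simp
  rw [e1, e2]
  linear_combination h + π * x * e

/-- The logarithmic integral against `1 / (cosh t + cos φ)`. -/
theorem integral_log_mul_inv_cosh_add_cos {φ : ℝ} (h1 : -π < φ) (h2 : φ < π) (h0 : φ ≠ 0) :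
    ∫ t in Set.Ioi (0 : ℝ), log t * (1 / (cosh t + cos φ) / 2) =
      π / (2 * sin φ) *
        log ((2 * π) ^ (φ / π) * Gamma (1 / 2 + φ / (2 * π)) / Gamma (1 / 2 - φ / (2 * π))) := by
  have hpi := pi_pos
  have hs : sin φ ≠ 0 := by
    rcases lt_or_gt_of_ne h0 with h | h
    · exact (sin_neg_of_neg_of_neg_pi_lt h h1).ne
    · exact (sin_pos_of_pos_of_lt_pi h h2).ne'
  have hx1 : φ / (2 * π) < 1 / 2 := by rw [div_lt_iff₀ (by positivity)]; linarith
  have hx2 : -(1 / 2) < φ / (2 * π) := by rw [lt_div_iff₀ (by positivity)]; linarith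
  -- This choice turns `-cos δ` into `cos φ` and keeps `sin δ = sin φ`.
  have h := integral_log_mul_sin_div_cosh_sub_cos (δ := π - φ) (by linarith) (by linarith)
  have e1 : (1 : ℝ) - (π - φ) / (2 * π) = 1 / 2 + φ / (2 * π) := by field_simp; ring
  have e2 : (π - φ) / (2 * π) = 1 / 2 - φ / (2 * π) := by field_simp
  have e3 : 1 - (π - φ) / π = φ / π := by field_simp; ring
  rw [e1, e2, e3, sin_pi_sub, cos_pi_sub] at h
  have hl : ∫ t in Set.Ioi (0 : ℝ), log t * (sin φ / (cosh t - -cos φ) / 2) =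
      sin φ * ∫ t in Set.Ioi (0 : ℝ), log t * (1 / (cosh t + cos φ) / 2) := by
    rw [← integral_const_mul]
    congr 1
    funext t
    ring
  rw [hl] at h
  have g1 := Gamma_pos_of_pos (show 0 < 1 / 2 + φ / (2 * π) by linarith)
  have g2 := Gamma_pos_of_pos (show 0 < 1 / 2 - φ / (2 * π) by linarith)
  rw [log_div (by positivity) g2.ne', log_mul (by positivity) g1.ne', log_rpow (by positivity)]
  rw [div_mul_eq_mul_div, eq_div_iff (by positivity)]
  linear_combination 2 * h

/-! ### Exponential changes of variable. -/

theorem exp_image_Ioi_zero : exp '' Set.Ioi 0 = Set.Ioi 1 := by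
  ext x
  constructor
  · rintro ⟨t, ht, rfl⟩
    exact one_lt_exp_iff.2 ht
  · intro hx
    have hx : 1 < x := hx
    exact ⟨log x, log_pos hx, exp_log (by linarith)⟩

theorem exp_neg_image_Ioi_zero : (fun t : ℝ => exp (-t)) '' Set.Ioi 0 = Set.Ioo 0 1 := by
  ext x
  constructor
  · rintro ⟨t, ht, rfl⟩
    exact ⟨exp_pos _, exp_lt_one_iff.2 (neg_lt_zero.2 ht)⟩
  · rintro ⟨h0, h1⟩
    refine ⟨-log x, neg_pos.2 (log_neg h0 h1), ?_⟩
    simp [exp_log h0]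

/-- The denominator is `2 exp t (cosh t + c)`, so the Jacobian cancels; evenness of `cosh` gives the
same kernel for `exp (-t)`. -/
theorem exp_smul_log_log_div (c t : ℝ) :
    |exp t| • (log (log (exp t)) / (1 + 2 * exp t * c + exp t ^ 2)) =
      log t * (1 / (cosh t + c) / 2) := by
  have he := exp_pos t
  have h : 1 + 2 * exp t * c + exp t ^ 2 = exp t * ((cosh t + c) * 2) := by
    rw [cosh_eq, exp_neg]
    field_simp
    ring
  rw [h, log_exp, abs_of_pos he, smul_eq_mul]
  field_simp

theorem exp_neg_smul_log_log_div (c t : ℝ) :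
    |(-exp (-t))| • (log (log (1 / exp (-t))) / (1 + 2 * exp (-t) * c + exp (-t) ^ 2)) =
      log t * (1 / (cosh t + c) / 2) := by
  have he := exp_pos (-t)
  have h : 1 + 2 * exp (-t) * c + exp (-t) ^ 2 = exp (-t) * ((cosh t + c) * 2) := by
    rw [← cosh_neg t, cosh_eq, exp_neg (-t)]
    field_simp
    ring
  rw [h, one_div, ← exp_neg, neg_neg, log_exp, abs_neg, abs_of_pos he, smul_eq_mul]
  field_simp

section
variable {φ : ℝ}

theorem hasDerivWithinAt_exp_neg (s : Set ℝ) (t : ℝ) :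
    HasDerivWithinAt (fun t : ℝ => exp (-t)) (-exp (-t)) s t := by
  simpa using ((hasDerivAt_neg t).exp).hasDerivWithinAt

theorem integrableOn_log_log_Ioi (h1 : -π < φ) (h2 : φ < π) :
    IntegrableOn (fun x : ℝ => log (log x) / (1 + 2 * x * cos φ + x ^ 2)) (Set.Ioi 1) := by
  rw [← exp_image_Ioi_zero, integrableOn_image_iff_integrableOn_abs_deriv_smul measurableSet_Ioi
    (fun t _ => (hasDerivAt_exp t).hasDerivWithinAt) exp_injective.injOn]
  simp only [exp_smul_log_log_div]
  exact integrableOn_log_mul_inv_cosh_add_cos h1 h2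

theorem integral_log_log_Ioi (φ : ℝ) :
    ∫ x in Set.Ioi (1 : ℝ), log (log x) / (1 + 2 * x * cos φ + x ^ 2) =
      ∫ t in Set.Ioi (0 : ℝ), log t * (1 / (cosh t + cos φ) / 2) := by
  rw [← exp_image_Ioi_zero, integral_image_eq_integral_abs_deriv_smul measurableSet_Ioi
    (fun t _ => (hasDerivAt_exp t).hasDerivWithinAt) exp_injective.injOn]
  simp only [exp_smul_log_log_div]

theorem injOn_exp_neg (s : Set ℝ) : Set.InjOn (fun t : ℝ => exp (-t)) s :=
  (exp_injective.comp neg_injective).injOn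

theorem intervalIntegrable_log_log_inv (h1 : -π < φ) (h2 : φ < π) :
    IntervalIntegrable
      (fun x : ℝ => log (log (1 / x)) / (1 + 2 * x * cos φ + x ^ 2)) volume 0 1 := by
  rw [intervalIntegrable_iff_integrableOn_Ioo_of_le zero_le_one, ← exp_neg_image_Ioi_zero,
    integrableOn_image_iff_integrableOn_abs_deriv_smul measurableSet_Ioi
    (fun t _ => hasDerivWithinAt_exp_neg _ t) (injOn_exp_neg _)]
  simp only [exp_neg_smul_log_log_div]
  exact integrableOn_log_mul_inv_cosh_add_cos h1 h2

theorem integral_log_log_inv (φ : ℝ) :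
    ∫ x in (0 : ℝ)..1, log (log (1 / x)) / (1 + 2 * x * cos φ + x ^ 2) =
      ∫ t in Set.Ioi (0 : ℝ), log t * (1 / (cosh t + cos φ) / 2) := by
  rw [intervalIntegral.integral_of_le zero_le_one, integral_Ioc_eq_integral_Ioo,
    ← exp_neg_image_Ioi_zero, integral_image_eq_integral_abs_deriv_smul measurableSet_Ioi
    (fun t _ => hasDerivWithinAt_exp_neg _ t) (injOn_exp_neg _)]
  simp only [exp_neg_smul_log_log_div]

end

/-! ### The removable singularity at `φ = 0`. -/

theorem tendsto_integral_log_mul_inv_cosh_add_cos :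
    Tendsto (fun φ => ∫ t in Set.Ioi (0 : ℝ), log t * (1 / (cosh t + cos φ) / 2)) (𝓝 0)
      (𝓝 (∫ t in Set.Ioi (0 : ℝ), log t * (1 / (cosh t + cos 0) / 2))) := by
  have hpi := pi_pos
  refine tendsto_integral_filter_of_dominated_convergence
    -- Near `0` one has `cos φ > 0 = cos (π / 2)`, so the integrand at `π / 2` dominates.
    (fun t => ‖log t * (1 / (cosh t + cos (π / 2)) / 2)‖)
    (Eventually.of_forall fun φ => by fun_prop) ?_
    (integrableOn_log_mul_inv_cosh_add_cos (by linarith) (by linarith)).norm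
    (Eventually.of_forall fun t => ?_)
  · have hev : ∀ᶠ φ : ℝ in 𝓝 0, 0 < cos φ :=
      continuous_cos.continuousAt.eventually (lt_mem_nhds (by simp))
    filter_upwards [hev] with φ hφ
    refine Eventually.of_forall fun t => ?_
    have hc := cosh_pos t
    rw [norm_mul, norm_mul, cos_pi_div_two, add_zero]
    refine mul_le_mul_of_nonneg_left ?_ (norm_nonneg _)
    rw [Real.norm_of_nonneg (by positivity), Real.norm_of_nonneg (by positivity)]
    gcongr
    linarith
  · have hc : cosh t + cos 0 ≠ 0 := by
      have := cosh_pos t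
      rw [cos_zero]
      positivity
    have : ContinuousAt (fun φ => log t * (1 / (cosh t + cos φ) / 2)) 0 := by
      fun_prop (disch := exact hc)
    exact this

/-! ### The substitution `x = tan y`. -/

theorem tan_image_Ioo : tan '' Set.Ioo (π / 4) (π / 2) = Set.Ioi 1 := by
  have hpi := pi_pos
  ext x
  constructor
  · rintro ⟨y, ⟨h1, h2⟩, rfl⟩
    have := tan_lt_tan_of_lt_of_lt_pi_div_two (by linarith) h2 h1
    rwa [tan_pi_div_four] at this
  · intro hx
    refine ⟨arctan x, ⟨?_, arctan_lt_pi_div_two x⟩, tan_arctan x⟩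
    rw [← arctan_one]
    exact arctan_strictMono hx

section
variable {y : ℝ}

theorem hasDerivWithinAt_tan_of_mem_Ioo (hy : y ∈ Set.Ioo (π / 4) (π / 2)) (s : Set ℝ) :
    HasDerivWithinAt tan (1 / cos y ^ 2) s y :=
  (hasDerivAt_tan (cos_pos_of_mem_Ioo
    ⟨by linarith [pi_pos, hy.1], hy.2⟩).ne').hasDerivWithinAt

theorem injOn_tan_Ioo : Set.InjOn tan (Set.Ioo (π / 4) (π / 2)) :=
  injOn_tan.mono (Set.Ioo_subset_Ioo (by linarith [pi_pos]) le_rfl)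

theorem smul_log_log_tan (hy : y ∈ Set.Ioo (π / 4) (π / 2)) :
    |1 / cos y ^ 2| • (log (log (tan y)) / (1 + tan y ^ 2)) = log (log (tan y)) := by
  have hc : cos y ≠ 0 := (cos_pos_of_mem_Ioo ⟨by linarith [pi_pos, hy.1], hy.2⟩).ne'
  have h : 1 + tan y ^ 2 = 1 / cos y ^ 2 := by
    rw [← inv_one_add_tan_sq hc]
    simp
  rw [h, abs_of_nonneg (by positivity), smul_eq_mul, mul_div_cancel₀]
  positivity

end

theorem intervalIntegrable_log_log_tan
    (h : IntegrableOn (fun x : ℝ => log (log x) / (1 + x ^ 2)) (Set.Ioi 1)) :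
    IntervalIntegrable (fun y : ℝ => log (log (tan y))) volume (π / 4) (π / 2) := by
  rw [intervalIntegrable_iff_integrableOn_Ioo_of_le (by linarith [pi_pos])]
  rw [← tan_image_Ioo, integrableOn_image_iff_integrableOn_abs_deriv_smul measurableSet_Ioo
    (fun y hy => hasDerivWithinAt_tan_of_mem_Ioo hy _) injOn_tan_Ioo] at h
  exact h.congr_fun (fun y hy => smul_log_log_tan hy) measurableSet_Ioo

theorem integral_log_log_tan :
    ∫ y in (π / 4)..(π / 2), log (log (tan y)) =
      ∫ x in Set.Ioi (1 : ℝ), log (log x) / (1 + x ^ 2) := by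
  rw [intervalIntegral.integral_of_le (by linarith [pi_pos]), integral_Ioc_eq_integral_Ioo,
    ← tan_image_Ioo, integral_image_eq_integral_abs_deriv_smul measurableSet_Ioo
    (fun y hy => hasDerivWithinAt_tan_of_mem_Ioo hy _) injOn_tan_Ioo]
  exact (setIntegral_congr_fun measurableSet_Ioo fun y hy => smul_log_log_tan hy).symm

/-! ### Special angles and assembly. -/

theorem cos_two_mul_pi_div_three : cos (2 * π / 3) = -(1 / 2) := by
  rw [show 2 * π / 3 = π - π / 3 by ring, cos_pi_sub, cos_pi_div_three]

theorem sin_two_mul_pi_div_three : sin (2 * π / 3) = √3 / 2 := by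
  rw [show 2 * π / 3 = π - π / 3 by ring, sin_pi_sub, sin_pi_div_three]

/-- Reflection at `1 / 6` gives `Gamma (1 / 6) * Gamma (5 / 6) = 2π`, which eliminates `Gamma (5 /
6)`. -/
theorem log_Gamma_five_sixths_mul :
    log (Gamma (5 / 6) * (2 * π) ^ (2 / 3 : ℝ) / Gamma (1 / 6)) =
      2 * (5 / 6 * log (2 * π) - log (Gamma (1 / 6))) := by
  have hpi := pi_pos
  have g1 : 0 < Gamma (1 / 6) := Gamma_pos_of_pos (by norm_num)
  have g5 : 0 < Gamma (5 / 6) := Gamma_pos_of_pos (by norm_num)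
  have h := Gamma_mul_Gamma_one_sub (1 / 6)
  rw [show (1 : ℝ) - 1 / 6 = 5 / 6 by norm_num, show π * (1 / 6) = π / 6 by ring,
    sin_pi_div_six] at h
  have h' : log (Gamma (1 / 6)) + log (Gamma (5 / 6)) = log (2 * π) := by
    rw [← log_mul g1.ne' g5.ne', h]
    congr 1
    ring
  rw [log_div (by positivity) g1.ne', log_mul g5.ne' (by positivity), log_rpow (by positivity)]
  linear_combination h'

theorem mainTheorem1 :
    -- convergence of both integrals and their equality
    (∀ φ : ℝ, -π < φ → φ < π →
      IntervalIntegrable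
          (fun x : ℝ => log (log (1 / x)) / (1 + 2 * x * cos φ + x ^ 2)) volume 0 1 ∧
      IntegrableOn
          (fun x : ℝ => log (log x) / (1 + 2 * x * cos φ + x ^ 2)) (Set.Ioi 1) volume ∧
      (∫ x in (0 : ℝ)..1, log (log (1 / x)) / (1 + 2 * x * cos φ + x ^ 2)) =
        ∫ x in Set.Ioi (1 : ℝ), log (log x) / (1 + 2 * x * cos φ + x ^ 2)) ∧
    -- the evaluation for `φ ≠ 0`
    (∀ φ : ℝ, -π < φ → φ < π → φ ≠ 0 →
      (∫ x in (0 : ℝ)..1, log (log (1 / x)) / (1 + 2 * x * cos φ + x ^ 2)) =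
        π / (2 * sin φ) *
          log ((2 * π) ^ (φ / π) * Gamma (1 / 2 + φ / (2 * π)) / Gamma (1 / 2 - φ / (2 * π)))) ∧
    -- the evaluation at the removable singularity `φ = 0`
    Tendsto
      (fun φ : ℝ => π / (2 * sin φ) *
          log ((2 * π) ^ (φ / π) * Gamma (1 / 2 + φ / (2 * π)) / Gamma (1 / 2 - φ / (2 * π))))
      (𝓝[≠] 0)
      (𝓝 (∫ x in (0 : ℝ)..1, log (log (1 / x)) / (1 + 2 * x * cos 0 + x ^ 2))) ∧
    -- the case `φ = π / 2`
    ((∫ x in (0 : ℝ)..1, log (log (1 / x)) / (1 + x ^ 2)) =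
        π / 2 * log (Gamma (3 / 4) * √(2 * π) / Gamma (1 / 4)) ∧
      (∫ x in Set.Ioi (1 : ℝ), log (log x) / (1 + x ^ 2)) =
        π / 2 * log (Gamma (3 / 4) * √(2 * π) / Gamma (1 / 4)) ∧
      IntervalIntegrable (fun y : ℝ => log (log (tan y))) volume (π / 4) (π / 2) ∧
      (∫ y in (π / 4)..(π / 2), log (log (tan y))) =
        π / 2 * log (Gamma (3 / 4) * √(2 * π) / Gamma (1 / 4))) ∧
    -- the case `φ = π / 3`
    ((∫ x in (0 : ℝ)..1, log (log (1 / x)) / (1 + x + x ^ 2)) =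
        π / √3 * log (Gamma (2 / 3) * (2 * π) ^ (1 / 3 : ℝ) / Gamma (1 / 3)) ∧
      (∫ x in Set.Ioi (1 : ℝ), log (log x) / (1 + x + x ^ 2)) =
        π / √3 * log (Gamma (2 / 3) * (2 * π) ^ (1 / 3 : ℝ) / Gamma (1 / 3))) ∧
    -- the case `φ = 2 * π / 3`
    ((∫ x in (0 : ℝ)..1, log (log (1 / x)) / (1 - x + x ^ 2)) =
        π / √3 * log (Gamma (5 / 6) * (2 * π) ^ (2 / 3 : ℝ) / Gamma (1 / 6)) ∧
      (∫ x in Set.Ioi (1 : ℝ), log (log x) / (1 - x + x ^ 2)) =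
        π / √3 * log (Gamma (5 / 6) * (2 * π) ^ (2 / 3 : ℝ) / Gamma (1 / 6)) ∧
      π / √3 * log (Gamma (5 / 6) * (2 * π) ^ (2 / 3 : ℝ) / Gamma (1 / 6)) =
        2 * π / √3 * (5 / 6 * log (2 * π) - log (Gamma (1 / 6)))) := by
  have hpi := pi_pos
  have eval1 : ∀ φ : ℝ, -π < φ → φ < π → φ ≠ 0 →
      (∫ x in (0 : ℝ)..1, log (log (1 / x)) / (1 + 2 * x * cos φ + x ^ 2)) =
        π / (2 * sin φ) *
          log ((2 * π) ^ (φ / π) * Gamma (1 / 2 + φ / (2 * π)) / Gamma (1 / 2 - φ / (2 * π))) :=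
    fun φ h1 h2 h0 => by rw [integral_log_log_inv, integral_log_mul_inv_cosh_add_cos h1 h2 h0]
  have eval2 : ∀ φ : ℝ, -π < φ → φ < π → φ ≠ 0 →
      (∫ x in Set.Ioi (1 : ℝ), log (log x) / (1 + 2 * x * cos φ + x ^ 2)) =
        π / (2 * sin φ) *
          log ((2 * π) ^ (φ / π) * Gamma (1 / 2 + φ / (2 * π)) / Gamma (1 / 2 - φ / (2 * π))) :=
    fun φ h1 h2 h0 => by rw [integral_log_log_Ioi, integral_log_mul_inv_cosh_add_cos h1 h2 h0]
  have half : ∀ x : ℝ, 1 + 2 * x * cos (π / 2) + x ^ 2 = 1 + x ^ 2 := fun x => by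
    rw [cos_pi_div_two]; ring
  have third : ∀ x : ℝ, 1 + 2 * x * cos (π / 3) + x ^ 2 = 1 + x + x ^ 2 := fun x => by
    rw [cos_pi_div_three]; ring
  have twothirds : ∀ x : ℝ, 1 + 2 * x * cos (2 * π / 3) + x ^ 2 = 1 - x + x ^ 2 := fun x => by
    rw [cos_two_mul_pi_div_three]; ring
  have vhalf : π / (2 * sin (π / 2)) * log ((2 * π) ^ (π / 2 / π) *
      Gamma (1 / 2 + π / 2 / (2 * π)) / Gamma (1 / 2 - π / 2 / (2 * π))) =
      π / 2 * log (Gamma (3 / 4) * √(2 * π) / Gamma (1 / 4)) := by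
    have e1 : π / 2 / π = 1 / 2 := by field_simp
    have e2 : 1 / 2 + π / 2 / (2 * π) = 3 / 4 := by field_simp; norm_num
    have e3 : 1 / 2 - π / 2 / (2 * π) = 1 / 4 := by field_simp; norm_num
    rw [e1, e2, e3, sin_pi_div_two, mul_one, sqrt_eq_rpow, mul_comm (Gamma _)]
  have vthird : π / (2 * sin (π / 3)) * log ((2 * π) ^ (π / 3 / π) *
      Gamma (1 / 2 + π / 3 / (2 * π)) / Gamma (1 / 2 - π / 3 / (2 * π))) =
      π / √3 * log (Gamma (2 / 3) * (2 * π) ^ (1 / 3 : ℝ) / Gamma (1 / 3)) := by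
    have e1 : π / 3 / π = 1 / 3 := by field_simp
    have e2 : 1 / 2 + π / 3 / (2 * π) = 2 / 3 := by field_simp; norm_num
    have e3 : 1 / 2 - π / 3 / (2 * π) = 1 / 3 := by field_simp; norm_num
    rw [e1, e2, e3, sin_pi_div_three, mul_div_cancel₀ _ two_ne_zero, mul_comm (Gamma _)]
  have vtwothirds : π / (2 * sin (2 * π / 3)) * log ((2 * π) ^ (2 * π / 3 / π) *
      Gamma (1 / 2 + 2 * π / 3 / (2 * π)) / Gamma (1 / 2 - 2 * π / 3 / (2 * π))) =
      π / √3 * log (Gamma (5 / 6) * (2 * π) ^ (2 / 3 : ℝ) / Gamma (1 / 6)) := by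
    have e1 : 2 * π / 3 / π = 2 / 3 := by field_simp
    have e2 : 1 / 2 + 2 * π / 3 / (2 * π) = 5 / 6 := by field_simp; norm_num
    have e3 : 1 / 2 - 2 * π / 3 / (2 * π) = 1 / 6 := by field_simp; norm_num
    rw [e1, e2, e3, sin_two_mul_pi_div_three, mul_div_cancel₀ _ two_ne_zero, mul_comm (Gamma _)]
  have half1 := eval1 (π / 2) (by linarith) (by linarith) (by positivity)
  have half2 := eval2 (π / 2) (by linarith) (by linarith) (by positivity)
  have halfInt := integrableOn_log_log_Ioi (φ := π / 2) (by linarith) (by linarith)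
  have third1 := eval1 (π / 3) (by linarith) (by linarith) (by positivity)
  have third2 := eval2 (π / 3) (by linarith) (by linarith) (by positivity)
  have twothirds1 := eval1 (2 * π / 3) (by linarith) (by linarith) (by positivity)
  have twothirds2 := eval2 (2 * π / 3) (by linarith) (by linarith) (by positivity)
  simp only [half, vhalf] at half1 half2 halfInt
  simp only [third, vthird] at third1 third2
  simp only [twothirds, vtwothirds] at twothirds1 twothirds2
  refine ⟨fun φ h1 h2 => ⟨intervalIntegrable_log_log_inv h1 h2, integrableOn_log_log_Ioi h1 h2,
    by rw [integral_log_log_inv, integral_log_log_Ioi]⟩, eval1, ?_,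
    ⟨half1, half2, intervalIntegrable_log_log_tan halfInt, integral_log_log_tan.trans half2⟩,
    ⟨third1, third2⟩, ⟨twothirds1, twothirds2, ?_⟩⟩
  -- The closed form equals the integral on a punctured neighbourhood of `0`, and the integral is
  -- continuous there.
  · rw [integral_log_log_inv]
    refine (tendsto_integral_log_mul_inv_cosh_add_cos.mono_left nhdsWithin_le_nhds).congr' ?_
    filter_upwards [self_mem_nhdsWithin,
      mem_nhdsWithin_of_mem_nhds (Ioo_mem_nhds (neg_lt_zero.2 hpi) hpi)] with φ h0 hφ
    exact integral_log_mul_inv_cosh_add_cos hφ.1 hφ.2 h0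
  · rw [log_Gamma_five_sixths_mul]
    ring
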